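/- **Setting.** Let $E$ be a countable set of environments and let $x,r$ (item and recommendation features) take values in measurable spaces. The data of a user are generated by a structural causal model with mutually independent exogenous noises over a directed acyclic graph, with the variables: the environment $e\in E$, the choice $y\in\{0,1\}$, an unobserved variable $c$, and three parts $a,b,s$ into which the features decompose without loss, $(x,r)\leftrightarrow(a,b,s)$, where $a=(x,r)_e^{\perp}$, $b=(x,r)_{y\wedge e}$, $s=(x,r)_y^{\perp}$. The arrows are - for a *causal* user $u_c$: $a\to y,\ b\to y,\ e\to b,\ e\to s,\ a\to b,\ b\to s$; - for an *anti-causal* user $u_{ac}$: $y\to a,\ y\to b,\ e\to b,\ e\to s,\ s\to b,\ a\to b$; plus a link between $e$ and $y$. We say that $y$ and $e$ are *confounded* if at least one of the following is present: a common cause $e\leftarrow c\to y$, a directed path represented by the arrow $e\to y$, or one represented by the arrow $y\to e$ (the whole graph must stay acyclic). Write $D^e$ for the conditional law given that the environment is $e$, and $(x(e),r(e))$ for the counterfactual features obtained by setting the environment to $e$ in the structural equations with the noises unchanged. A measurable $f_u:(x,r)\mapsto\mathbb R$ is *counterfactually invariant* (CI) for user $u$ if $f_u(x(e),r(e))=f_u(x(e'),r(e'))$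 almost surely for all $e,e'\in E$. The part $a=(x,r)_e^\perp$ is the variable that characterizes this: every measurable function of $a$ is CI, and if $f_u$ is CI then $f_u(x,r)$ is almost surely a measurable function of $a$. A causal model is *faithful* if every conditional independence $v\perp w\mid S$ that holds among its observed variables (all except $c$) is entailed by d-separation in its graph. **Proposition.** Suppose that the data of $u_c$ and of $u_{ac}$ are generated by models of the causal and of the anti-causal kind, respectively (with the same spaces of environments and features), in both of which $y$ and $e$ are confounded. Let $f=(f_{u_c},f_{u_{ac}})$, with $f_{u_c}$ CI for $u_c$ and $f_{u_{ac}}$ CI for $u_{ac}$. Then: 1. $D^e(f_{u_c}(x,r))=D^{e'}(f_{u_c}(x,r))$ for all environments $e,e'$ of positive probability; 2. $D^e(f_{u_{ac}}(x,r)\mid y)=D^{e'}(f_{u_{ac}}(x,r)\mid y)$ for all $y\in\{0,1\}$ and all $e,e'$ such that $(e,y)$ and $(e',y)$ have positive probability. On the other hand, $f_{u_{ac}}$ need not satisfy condition 1 and $f_{u_c}$ need not satisfy condition 2: whenever the two models are moreover faithful, there are $\{0,1\}$-valued functions $f_{u_c},f_{u_{ac}}$, CI for $u_c$ and $u_{ac}$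 respectively, such that the law of $f_{u_{ac}}(x,r)$ is not the same under all $D^e$, and the conditional law of $f_{u_c}(x,r)$ given $y$ is not the same under all $D^e$. Such faithful models, with $e$ and $y$ confounded exactly by a common cause and with two environments, exist. -/

import Mathlib

open MeasureTheory ProbabilityTheory

noncomputable section

namespace CausalUsers

/-! ### Directed acyclic graphs and d-separation -/

/-- A directed acyclic graph on the vertex set `V`. -/
structure DAG (V : Type) where
  Edge : V → V → Prop
  acyclic : ∀ v, ¬ Relation.TransGen Edge v v

namespace DAG

variable {V : Type}

theorem wellFounded [Finite V] (G : DAG V) : WellFounded G.Edge := by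
  have hirr : Std.Irrefl (Relation.TransGen G.Edge) := ⟨G.acyclic⟩
  have h : WellFounded (Relation.TransGen G.Edge) := Finite.wellFounded_of_trans_of_irrefl _
  exact Subrelation.wf (fun hab => Relation.TransGen.single hab) h

/-- `b` is a collider on the path segment `a, b, c`. -/
def Collider (G : DAG V) (a b c : V) : Prop := G.Edge a b ∧ G.Edge c b

/-- The segment `a, b, c` of a path is not blocked by `S`: a collider must have a descendant
(possibly itself) in `S`, and a non-collider must lie outside `S`. -/
def Unblocked (G : DAG V) (S : Set V) (a b c : V) : Prop :=
  (G.Collider a b c → ∃ d ∈ S, Relation.ReflTransGen G.Edge b d) ∧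
    (¬ G.Collider a b c → b ∉ S)

/-- `p` is a path between `i` and `j` in the skeleton of `G`, without repeated vertices, that is
active given `S`. -/
def IsActivePath (G : DAG V) (S : Set V) (i j : V) (p : List V) : Prop :=
  p.head? = some i ∧ p.getLast? = some j ∧ p.Nodup ∧
    p.IsChain (fun a b => G.Edge a b ∨ G.Edge b a) ∧
    ∀ a b c, [a, b, c] <:+: p → G.Unblocked S a b c

/-- d-separation of two vertices by a set of vertices. -/
def DSep (G : DAG V) (i j : V) (S : Set V) : Prop := ¬ ∃ p, G.IsActivePath S i j p

end DAG

/-! ### Structural causal models -/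

/-- A structural causal model over the graph `G` with node spaces `α`: each node has its own
exogenous noise (the noises are mutually independent, see `SCM.prob`), and is a measurable function
of the values of its parents and of its noise. -/
structure SCM {V : Type} (G : DAG V) (α : V → Type) [∀ v, MeasurableSpace (α v)] where
  Noise : V → Type
  [noiseSpace : ∀ v, MeasurableSpace (Noise v)]
  law : ∀ v, Measure (Noise v)
  [isProb : ∀ v, IsProbabilityMeasure (law v)]
  mech : ∀ v, (∀ p : {p // G.Edge p v}, α p) → Noise v → α v
  measurable_mech : ∀ v,
    Measurable (fun z : (∀ p : {p // G.Edge p v}, α p) × Noise v => mech v z.1 z.2)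

attribute [instance] SCM.noiseSpace SCM.isProb

namespace SCM

variable {V : Type} {G : DAG V} {α : V → Type} [∀ v, MeasurableSpace (α v)]

/-- The sample space: all exogenous noises. -/
abbrev Sample (M : SCM G α) : Type := ∀ v, M.Noise v

/-- The joint law of the noises, under which they are mutually independent. -/
def prob [Fintype V] (M : SCM G α) : Measure M.Sample := Measure.pi M.law

/-- The values of all nodes, obtained by solving the structural equations along the graph. -/
def value [Finite V] (M : SCM G α) (ω : M.Sample) : ∀ v, α v :=
  G.wellFounded.fix fun v ih => M.mech v (fun p => ih p.1 p.2) (ω v)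

/-- The intervention that sets node `w` to the value `a`, leaving all other mechanisms and all
noises as they are. -/
def intervene [DecidableEq V] (M : SCM G α) (w : V) (a : α w) : SCM G α where
  Noise := M.Noise
  law := M.law
  mech := Function.update M.mech w fun _ _ => a
  measurable_mech := by
    intro v
    by_cases h : v = w
    · subst h
      simp
    · simpa [Function.update_of_ne h] using M.measurable_mech v

/-- The value of node `v` that would have been seen, at the same noises, had node `w` been set
to `a`. -/
def potential [Finite V] [DecidableEq V] (M : SCM G α) (w : V) (a : α w) (ω : M.Sample) :
    ∀ v, α v :=
  (M.intervene w a).value ω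

/-- The σ-algebra generated by the values of the nodes in `S`. -/
abbrev sigma [Finite V] (M : SCM G α) (S : Set V) : MeasurableSpace M.Sample :=
  ⨆ v ∈ S, MeasurableSpace.comap (fun ω => M.value ω v) inferInstance

/-- Nodes `i` and `j` are conditionally independent given the nodes in `S`. -/
def CondIndepNodes [Fintype V] (M : SCM G α) (i j : V) (S : Set V) : Prop :=
  ∀ (s : Set (α i)) (t : Set (α j)), MeasurableSet s → MeasurableSet t →
    M.prob⟦{ω | M.value ω i ∈ s} ∩ {ω | M.value ω j ∈ t} | M.sigma S⟧ =ᵐ[M.prob]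
      M.prob⟦{ω | M.value ω i ∈ s} | M.sigma S⟧ * M.prob⟦{ω | M.value ω j ∈ t} | M.sigma S⟧

/-- Faithfulness, for the set `O` of observed nodes: a conditional independence statement among
observed nodes that is not entailed by the graph (by d-separation) does not hold. -/
def Faithful [Fintype V] (M : SCM G α) (O : Set V) : Prop :=
  ∀ i ∈ O, ∀ j ∈ O, ∀ S ⊆ O, i ≠ j → i ∉ S → j ∉ S →
    ¬ G.DSep i j S → ¬ M.CondIndepNodes i j S

end SCM

/-! ### Causal and anti-causal users -/

inductive UserType where
  | causal
  | antiCausal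

/-- The variables: the environment `e`, the choice `y`, an unobserved variable `c`, and the three
parts of the features `(x, r)`. `inv` is the part not affected by `e`, `spur` is the part
neither causing nor caused by `y`, and `mix` is the remaining part. -/
inductive Node where
  | env
  | label
  | confounder
  | inv
  | mix
  | spur
  deriving DecidableEq

instance : Fintype Node :=
  ⟨{.env, .label, .confounder, .inv, .mix, .spur}, by intro v; cases v <;> decide⟩

/-- The ways in which `e` and `y` are linked other than through the features: an unobserved common
cause, or a directed path in one of the two directions (unobserved mediators on such a path are
absorbed into the noise of its end point). -/
structure Link where
  commonCause : Prop
  envToLabel : Prop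
  labelToEnv : Prop

/-- The arrows of the graphs for causal and for anti-causal users. -/
def edge (t : UserType) (L : Link) : Node → Node → Prop
  | .confounder, .env => L.commonCause
  | .confounder, .label => L.commonCause
  | .env, .label => L.envToLabel
  | .label, .env => L.labelToEnv
  | .env, .mix => True
  | .env, .spur => True
  | .inv, .mix => True
  | .inv, .label => t = .causal
  | .mix, .label => t = .causal
  | .mix, .spur => t = .causal
  | .label, .inv => t = .antiCausal
  | .label, .mix => t = .antiCausal
  | .spur, .mix => t = .antiCausal
  | _, _ => False

/-- The spaces in which the variables take their values; the choice is binary. -/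
def Val (E C I M S : Type) : Node → Type
  | .env => E
  | .label => Bool
  | .confounder => C
  | .inv => I
  | .mix => M
  | .spur => S

instance Val.instMeasurableSpace (E C I M S : Type) [hE : MeasurableSpace E]
    [hC : MeasurableSpace C] [hI : MeasurableSpace I] [hM : MeasurableSpace M]
    [hS : MeasurableSpace S] : ∀ v, MeasurableSpace (Val E C I M S v)
  | .env => hE
  | .label => inferInstanceAs (MeasurableSpace Bool)
  | .confounder => hC
  | .inv => hI
  | .mix => hM
  | .spur => hS

/-- A data generating process for a user of type `t`, with environments in `E`, item features in
`𝒳` and recommendation features in `ℛ`: a structural causal model over the graph of type `t`,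
together with a lossless decomposition of `(x, r)` into its three parts. -/
structure UserModel (t : UserType) (E 𝒳 ℛ : Type) [MeasurableSpace E] [MeasurableSpace 𝒳]
    [MeasurableSpace ℛ] where
  link : Link
  acyclic : ∀ v, ¬ Relation.TransGen (edge t link) v v
  Conf : Type
  Inv : Type
  Mix : Type
  Spur : Type
  [confSpace : MeasurableSpace Conf]
  [invSpace : MeasurableSpace Inv]
  [mixSpace : MeasurableSpace Mix]
  [spurSpace : MeasurableSpace Spur]
  scm : SCM ⟨edge t link, acyclic⟩ (Val E Conf Inv Mix Spur)
  combine : Inv × Mix × Spur → 𝒳 × ℛ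
  split : 𝒳 × ℛ → Inv × Mix × Spur
  measurable_combine : Measurable combine
  measurable_split : Measurable split
  split_combine : ∀ z, split (combine z) = z

attribute [instance] UserModel.confSpace UserModel.invSpace UserModel.mixSpace UserModel.spurSpace

namespace UserModel

variable {t : UserType} {E 𝒳 ℛ : Type} [MeasurableSpace E] [MeasurableSpace 𝒳]
  [MeasurableSpace ℛ]

/-- `y` and `e` are confounded: they share an unobserved common cause or are connected by a
directed path. -/
def Confounded (M : UserModel t E 𝒳 ℛ) : Prop :=
  M.link.commonCause ∨ M.link.envToLabel ∨ M.link.labelToEnv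

def Ω (M : UserModel t E 𝒳 ℛ) : Type := M.scm.Sample

instance instMeasurableSpaceΩ (M : UserModel t E 𝒳 ℛ) : MeasurableSpace M.Ω :=
  inferInstanceAs (MeasurableSpace M.scm.Sample)

def prob (M : UserModel t E 𝒳 ℛ) : Measure M.Ω := M.scm.prob

def env (M : UserModel t E 𝒳 ℛ) (ω : M.Ω) : E := M.scm.value ω .env

def label (M : UserModel t E 𝒳 ℛ) (ω : M.Ω) : Bool := M.scm.value ω .label

def inv (M : UserModel t E 𝒳 ℛ) (ω : M.Ω) : M.Inv := M.scm.value ω .inv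

/-- The observed features `(x, r)`. -/
def features (M : UserModel t E 𝒳 ℛ) (ω : M.Ω) : 𝒳 × ℛ :=
  M.combine (M.scm.value ω .inv, M.scm.value ω .mix, M.scm.value ω .spur)

/-- The counterfactual features `(x(e), r(e))` that would have been seen had the environment been
set to `e`. -/
def featuresAt (M : UserModel t E 𝒳 ℛ) (e : E) (ω : M.Ω) : 𝒳 × ℛ :=
  M.combine (M.scm.potential .env e ω .inv, M.scm.potential .env e ω .mix,
    M.scm.potential .env e ω .spur)

/-- Counterfactual invariance (CI) of a predictor: `f (x(e), r(e)) = f (x(e'), r(e'))` almost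
surely, for all environments. -/
def CI (M : UserModel t E 𝒳 ℛ) (f : 𝒳 × ℛ → ℝ) : Prop :=
  ∀ e e' : E, (fun ω => f (M.featuresAt e ω)) =ᵐ[M.prob] fun ω => f (M.featuresAt e' ω)

/-- The node `inv` is the variable that characterizes counterfactual invariance: a predictor
that depends on `(x, r)` through `inv` only is CI, and every CI predictor is, almost surely,
a measurable function of `inv`. -/
def InvCharacterizesCI (M : UserModel t E 𝒳 ℛ) : Prop :=
  (∀ g : M.Inv → ℝ, Measurable g → M.CI fun z => g (M.split z).1) ∧
    ∀ f : 𝒳 × ℛ → ℝ, Measurable f → M.CI f →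
      ∃ g : M.Inv → ℝ, Measurable g ∧
        (fun ω => f (M.features ω)) =ᵐ[M.prob] fun ω => g (M.inv ω)

/-- The model is faithful: its observed variables (all but `c`) satisfy no conditional independence
that is not entailed by the graph. -/
def Faithful (M : UserModel t E 𝒳 ℛ) : Prop := M.scm.Faithful {v | v ≠ .confounder}

/-- `D^e(f(x,r)) = D^{e'}(f(x,r))` for all environments `e, e'` (of positive probability), where
`D^e` is the conditional law given that the environment is `e`. -/
def MarginalInvariance (M : UserModel t E 𝒳 ℛ) (f : 𝒳 × ℛ → ℝ) : Prop :=
  ∀ e e' : E, M.prob {ω | M.env ω = e} ≠ 0 → M.prob {ω | M.env ω = e'} ≠ 0 →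
    (M.prob[|{ω | M.env ω = e}]).map (fun ω => f (M.features ω)) =
      (M.prob[|{ω | M.env ω = e'}]).map (fun ω => f (M.features ω))

/-- `D^e(f(x,r) | y) = D^{e'}(f(x,r) | y)` for all environments `e, e'` and all `y` (for which both
sides are defined, that is, the events conditioned on have positive probability). -/
def ConditionalInvariance (M : UserModel t E 𝒳 ℛ) (f : 𝒳 × ℛ → ℝ) : Prop :=
  ∀ (y : Bool) (e e' : E), M.prob {ω | M.env ω = e ∧ M.label ω = y} ≠ 0 →
    M.prob {ω | M.env ω = e' ∧ M.label ω = y} ≠ 0 →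
    (M.prob[|{ω | M.env ω = e ∧ M.label ω = y}]).map (fun ω => f (M.features ω)) =
      (M.prob[|{ω | M.env ω = e' ∧ M.label ω = y}]).map (fun ω => f (M.features ω))

end UserModel

end CausalUsers

end

/-! By hypothesis a CI predictor is almost surely a function of `inv`, so both invariances concern
the conditional law of `inv`. In the causal graph `inv` has no parents and `env` is not its
descendant, since an arrow from `label` to `env` would close a cycle through `mix`; hence `inv` is a
function of its own noise, which is independent of `env`. In the anti-causal graph the only parent
of `inv` is `label`, and neither `env` nor `label` descends from `inv`; hence, given `env` and
`label`, its law is its mechanism evaluated at the label. Both are instances of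
`SCM.cond_map_value`.

For the failures, indicators of `inv ∈ A` are CI. If all of them had the invariance in question,
countability of `E` would give independence of `inv` and `env`, conditionally on `label` for the
causal user and unconditionally for the anti-causal one. Confounding supplies an active path through
`label`: in the causal graph a collider opened by conditioning, in the anti-causal graph a path
without colliders. Faithfulness excludes the independence. The passage between conditional
expectations and elementary probabilities rests on atoms (`CondIndepNodes.mul_eq`,
`condIndepNodes_of_mul_eq`).

The example has binary variables, each true with probability `(1 + k) / 6`, where `k` counts its
true parents. All noise vectors have positive mass, so CI holds pointwise, and coupled
configurations in the two environments force a CI function to ignore `mix` and `spur`. Faithfulness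
is a finite computation: each pair and conditioning set gets either an inequality between integer
weights or a certificate of d-separation. -/

namespace CausalUsers

/-! ### Certificates for d-separation -/

namespace DAG

variable {V : Type}

/-- A vertex outside a set closed under taking children is not a descendant of a vertex of it. -/
theorem not_reflTransGen_of_closed {r : V → V → Prop} {D : Set V}
    (hD : ∀ a b, r a b → a ∈ D → b ∈ D) {w v : V} (hw : w ∈ D) (hv : v ∉ D) :
    ¬ Relation.ReflTransGen r w v := by
  intro h
  refine hv ?_
  clear hv
  induction h with
  | refl => exact hw
  | tail _ hab ih => exact hD _ _ hab ih

/-- A certificate for d-separation: a relation that contains the first steps from `i` and is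
closed under unblocked continuation, but never arrives at `j`. -/
theorem DSep.of_invariant {G : DAG V} {S : Set V} {i j : V} (R : V → V → Prop) (hij : i ≠ j)
    (h0 : ∀ v, G.Edge i v ∨ G.Edge v i → R i v)
    (hs : ∀ a b c, R a b → (G.Edge b c ∨ G.Edge c b) → G.Unblocked S a b c → R b c)
    (hj : ∀ a, ¬ R a j) : G.DSep i j S := by
  -- Induction along the path with its last step as state: whether it may continue past `b` depends
  -- on the edge by which it reached `b`.
  have key : ∀ (l : List V) (a b : V), R a b →
      (a :: b :: l).IsChain (fun a b => G.Edge a b ∨ G.Edge b a) →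
      (∀ x y z, [x, y, z] <:+: (a :: b :: l) → G.Unblocked S x y z) →
      (a :: b :: l).getLast? ≠ some j := by
    intro l
    induction l with
    | nil =>
      intro a b hab _ _ h
      simp only [List.getLast?_cons_cons, List.getLast?_singleton, Option.some.injEq] at h
      exact hj a (h ▸ hab)
    | cons c l ih =>
      intro a b hab hc hu h
      rw [List.isChain_cons_cons] at hc
      have hbc := hs a b c hab (List.isChain_cons_cons.1 hc.2).1
        (hu a b c ⟨[], l, by simp⟩)
      refine ih b c hbc hc.2 (fun x y z hx => hu x y z (hx.trans (List.suffix_cons _ _).isInfix)) ?_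
      simpa using h
  rintro ⟨p, hh, hl, -, hc, hu⟩
  match p, hh, hl, hc, hu with
  | [a], hh, hl, _, _ =>
    simp only [List.head?_cons, Option.some.injEq, List.getLast?_singleton] at hh hl
    exact hij (hh.symm.trans hl)
  | a :: b :: l, hh, hl, hc, hu =>
    simp only [List.head?_cons, Option.some.injEq] at hh
    subst hh
    exact key l a b (h0 b (List.isChain_cons_cons.1 hc).1) hc hu hl

end DAG

/-! ### Solutions of the structural equations and independence of the noises -/

namespace SCM

variable {V : Type} {G : DAG V} {α : V → Type} [∀ v, MeasurableSpace (α v)]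

theorem value_eq [Finite V] (M : SCM G α) (ω : M.Sample) (v : V) :
    M.value ω v = M.mech v (fun p => M.value ω p) (ω v) := by
  rw [value, WellFounded.fix_eq]

/-- Acyclicity makes the solution unique. This turns the event of a full configuration into separate
conditions on the individual noises. -/
theorem value_eq_iff [Finite V] (M : SCM G α) (ω : M.Sample) (x : ∀ v, α v) :
    M.value ω = x ↔ ∀ v, M.mech v (fun p => x p) (ω v) = x v := by
  constructor
  · rintro rfl v
    exact (M.value_eq ω v).symm
  · intro h
    funext v
    induction v using G.wellFounded.induction with
    | _ v ih =>
      rw [M.value_eq, ← h v]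
      congr 1
      funext p
      exact ih p p.2

theorem measurable_value [Finite V] (M : SCM G α) (v : V) :
    Measurable fun ω => M.value ω v := by
  induction v using G.wellFounded.induction with
  | _ v ih =>
    simp_rw [M.value_eq _ v]
    exact (M.measurable_mech v).comp
      ((measurable_pi_lambda _ fun p : {p // G.Edge p v} => ih p p.2).prodMk (measurable_pi_apply v))

/-- Parents of a non-descendant of `w` are again non-descendants, so the noise of `w` never enters
the recursion. -/
theorem value_update [Finite V] [DecidableEq V] (M : SCM G α) {w v : V}
    (h : ¬ Relation.ReflTransGen G.Edge w v) (ω : M.Sample) (n : M.Noise w) :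
    M.value (Function.update ω w n) v = M.value ω v := by
  induction v using G.wellFounded.induction with
  | _ v ih =>
    rw [M.value_eq, M.value_eq ω]
    have hv : v ≠ w := by
      rintro rfl
      exact h .refl
    rw [Function.update_of_ne hv]
    congr 1
    funext p
    exact ih p p.2 fun hp => h (hp.tail p.2)

theorem potential_eq [Finite V] [DecidableEq V] (M : SCM G α) {w v : V} (a : α w)
    (h : ¬ Relation.ReflTransGen G.Edge w v) (ω : M.Sample) :
    M.potential w a ω v = M.value ω v := by
  induction v using G.wellFounded.induction with
  | _ v ih =>
    have hv : v ≠ w := by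
      rintro rfl
      exact h .refl
    have h1 : M.potential w a ω v = M.mech v (fun p => M.potential w a ω p) (ω v) := by
      refine ((M.intervene w a).value_eq ω v).trans ?_
      simp only [intervene, Function.update_of_ne hv]
      rfl
    rw [M.value_eq ω, h1]
    congr 1
    funext p
    exact ih p p.2 fun hp => h (hp.tail p.2)

theorem potential_eq_iff [Finite V] [DecidableEq V] (M : SCM G α) {w : V} (ω : M.Sample)
    (x : ∀ v, α v) :
    M.potential w (x w) ω = x ↔ ∀ v, v ≠ w → M.mech v (fun p => x p) (ω v) = x v := by
  refine ((M.intervene w (x w)).value_eq_iff ω x).trans ?_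
  constructor
  · intro h v hv
    simpa [intervene, Function.update_of_ne hv] using h v
  · intro h v
    by_cases hv : v = w
    · subst hv
      simp [intervene]
    · simpa [intervene, Function.update_of_ne hv] using h v hv

instance [Fintype V] (M : SCM G α) : IsProbabilityMeasure M.prob :=
  inferInstanceAs (IsProbabilityMeasure (Measure.pi M.law))

/-- The noise of `w` is independent of everything that does not depend on it. -/
theorem indepFun_noise [Fintype V] [DecidableEq V] (M : SCM G α) (w : V) {β : Type*}
    [MeasurableSpace β] {F : M.Sample → β} (hF : Measurable F)
    (hw : ∀ ω n, F (Function.update ω w n) = F ω) :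
    IndepFun (fun ω : M.Sample => ω w) F M.prob := by
  have hi : iIndepFun (fun v (ω : M.Sample) => ω v) M.prob :=
    iIndepFun_pi (X := fun v (n : M.Noise v) => n) fun _ => aemeasurable_id
  have h := hi.indepFun_finset {w} (Finset.univ.erase w) (by simp) fun v => measurable_pi_apply v
  -- `F` factors through the other noises: fill the coordinate `w` with an arbitrary fixed `n₀`.
  obtain ⟨n₀⟩ : Nonempty (M.Noise w) := nonempty_of_isProbabilityMeasure (M.law w)
  let ext : (∀ v : (Finset.univ.erase w : Finset V), M.Noise v) → M.Sample := fun x v =>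
    if hv : v = w then hv ▸ n₀ else x ⟨v, by simp [hv]⟩
  have hext : Measurable ext := by
    refine measurable_pi_lambda _ fun v => ?_
    by_cases hv : v = w
    · subst hv
      simp [ext]
    · simp only [ext, hv, dite_false]
      exact measurable_pi_apply _
  have hev : Measurable fun x : (∀ v : ({w} : Finset V), M.Noise v) => x ⟨w, by simp⟩ :=
    measurable_pi_apply _
  have := h.comp (ψ := F ∘ ext) hev (hF.comp hext)
  have hF' : F = (F ∘ ext) ∘ fun ω (v : (Finset.univ.erase w : Finset V)) => ω v := by
    funext ω
    rw [← hw ω n₀]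
    refine congrArg F (funext fun v => ?_)
    by_cases hv : v = w
    · subst hv
      simp [ext]
    · simp [ext, hv]
  rw [hF']
  exact this

/-- On an event `Q` that does not depend on the noise of `w` and on which the parents of `w` are
constant, the conditional law of `w` is given by its mechanism. -/
theorem cond_map_value [Fintype V] [DecidableEq V] (M : SCM G α) (w : V) {Q : Set M.Sample}
    (hQ : MeasurableSet Q) (hw : ∀ ω n, Function.update ω w n ∈ Q ↔ ω ∈ Q)
    (x : ∀ p : {p // G.Edge p w}, α p) (hx : ∀ ω ∈ Q, ∀ p, M.value ω p.1 = x p)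
    (h0 : M.prob Q ≠ 0) :
    (M.prob[|Q]).map (fun ω => M.value ω w) = (M.law w).map (M.mech w x) := by
  have hmech : Measurable (M.mech w x) := (M.measurable_mech w).comp measurable_prodMk_left
  have hind : IndepFun (fun ω : M.Sample => ω w) (fun ω => ω ∈ Q) M.prob :=
    M.indepFun_noise w (measurable_mem.2 hQ) fun ω n => propext (hw ω n)
  ext A hA
  rw [Measure.map_apply (M.measurable_value w) hA, Measure.map_apply hmech hA,
    cond_apply hQ]
  -- With the parents frozen on `Q`, the event for `w` concerns its own noise only, and independence
  -- factors the probability.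
  have h1 : Q ∩ (fun ω => M.value ω w) ⁻¹' A =
      (fun ω : M.Sample => ω w) ⁻¹' (M.mech w x ⁻¹' A) ∩ (fun ω => ω ∈ Q) ⁻¹' {True} := by
    ext ω
    simp only [Set.mem_inter_iff, Set.mem_preimage, Set.mem_singleton_iff, eq_iff_iff, iff_true]
    rw [and_comm]
    refine and_congr_left fun hω => ?_
    rw [M.value_eq]
    have : (fun p : {p // G.Edge p w} => M.value ω p) = x := funext fun p => hx ω hω p
    rw [this]
  have h2 : (fun ω => ω ∈ Q) ⁻¹' {True} = Q := by
    ext ω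
    simp
  have h3 : M.prob ((fun ω : M.Sample => ω w) ⁻¹' (M.mech w x ⁻¹' A)) =
      M.law w (M.mech w x ⁻¹' A) :=
    (measurePreserving_eval M.law w).measure_preimage (hmech hA).nullMeasurableSet
  rw [h1, hind.measure_inter_preimage_eq_mul _ _ (hmech hA) (measurableSet_singleton _), h2, h3,
    mul_comm, mul_assoc, ENNReal.mul_inv_cancel h0 (measure_ne_top _ _), mul_one]

end SCM

/-! ### Conditional probabilities on atoms -/

/-- `T` is an atom of the σ-algebra `m` (possibly empty). -/
structure IsAtomOf {Ω : Type*} (m : MeasurableSpace Ω) (T : Set Ω) : Prop where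
  measurableSet : MeasurableSet[m] T
  subset_or_compl : ∀ U, MeasurableSet[m] U → T ⊆ U ∨ T ⊆ Uᶜ

/-- On an atom, a conditional probability is the elementary one. -/
theorem IsAtomOf.condExp_mul {Ω : Type*} {m m0 : MeasurableSpace Ω} {μ : Measure Ω}
    [IsFiniteMeasure μ] (hm : m ≤ m0) {T : Set Ω} (hT : IsAtomOf m T) {A : Set Ω}
    (hA : MeasurableSet A) {ω : Ω} (hω : ω ∈ T) : (μ⟦A | m⟧) ω * μ.real T = μ.real (A ∩ T) := by
  have hmeas : Measurable[m] (μ⟦A | m⟧) := stronglyMeasurable_condExp.measurable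
  -- The level set of the conditional expectation through `ω` is `m`-measurable and meets the atom
  -- `T`, hence contains it.
  have hc : ∀ ω' ∈ T, (μ⟦A | m⟧) ω' = (μ⟦A | m⟧) ω := by
    have h := hT.subset_or_compl _ (hmeas (measurableSet_singleton ((μ⟦A | m⟧) ω)))
    rcases h with h | h
    · exact fun ω' h' => h h'
    · exact absurd rfl (h hω)
  have h1 : ∫ x in T, (μ⟦A | m⟧) x ∂μ = ∫ x in T, A.indicator (fun _ => (1 : ℝ)) x ∂μ :=
    setIntegral_condExp hm ((integrable_const 1).indicator hA) hT.measurableSet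
  rw [setIntegral_congr_fun (hm _ hT.measurableSet) hc, setIntegral_const,
    integral_indicator hA, Measure.restrict_restrict hA] at h1
  simpa [mul_comm] using h1

/-! ### Conditional independence tested on atoms -/

namespace SCM

variable {V : Type} {G : DAG V} {α : V → Type} [∀ v, MeasurableSpace (α v)]

theorem sigma_le [Finite V] (M : SCM G α) (S : Set V) :
    M.sigma S ≤ MeasurableSpace.pi :=
  iSup₂_le fun v _ => (M.measurable_value v).comap_le

theorem isAtomOf_sigma [Finite V] (M : SCM G α) (S : Set V)
    (hS : ∀ v ∈ S, MeasurableSingletonClass (α v)) (z : ∀ v, α v) :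
    IsAtomOf (M.sigma S) {ω | ∀ v ∈ S, M.value ω v = z v} where
  measurableSet := by
    have : {ω | ∀ v ∈ S, M.value ω v = z v} =
        ⋂ v ∈ S, (fun ω => M.value ω v) ⁻¹' {z v} := by
      ext
      simp
    rw [this]
    refine MeasurableSet.biInter S.to_countable fun v hv => ?_
    have := hS v hv
    have hle : MeasurableSpace.comap (fun ω => M.value ω v) inferInstance ≤ M.sigma S :=
      le_iSup₂ (f := fun v (_ : v ∈ S) =>
        MeasurableSpace.comap (fun ω => M.value ω v) inferInstance) v hv
    exact hle _ ⟨{z v}, measurableSet_singleton _, rfl⟩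
  subset_or_compl := by
    intro U hU
    set T := {ω | ∀ v ∈ S, M.value ω v = z v}
    -- The sets that contain `T` or miss it form a σ-algebra, and it contains the generators of
    -- `M.sigma S`.
    let m' : MeasurableSpace M.Sample :=
      { MeasurableSet' := fun U => T ⊆ U ∨ T ⊆ Uᶜ
        measurableSet_empty := by simp
        measurableSet_compl := fun U h => by simpa [or_comm] using h
        measurableSet_iUnion := fun f h => by
          by_cases hf : ∃ n, T ⊆ f n
          · obtain ⟨n, hn⟩ := hf
            exact Or.inl (hn.trans (Set.subset_iUnion f n))
          · right
            rw [Set.compl_iUnion]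
            exact Set.subset_iInter fun n => (h n).resolve_left fun hn => hf ⟨n, hn⟩ }
    have hle : M.sigma S ≤ m' := by
      refine iSup₂_le fun v hv => ?_
      rintro _ ⟨B, -, rfl⟩
      by_cases hz : z v ∈ B
      · left
        intro ω hω
        simpa [hω v hv] using hz
      · right
        intro ω hω
        simpa [hω v hv] using hz
    exact hle U hU

theorem isAtomOf_sigma_singleton [Finite V] (M : SCM G α) (w : V)
    [hw : MeasurableSingletonClass (α w)] (a : α w) :
    IsAtomOf (M.sigma {w}) {ω | M.value ω w = a} := by
  by_cases ha : ∃ ω₀, M.value ω₀ w = a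
  · obtain ⟨ω₀, rfl⟩ := ha
    have := M.isAtomOf_sigma {w} (by rintro v rfl; exact hw) (M.value ω₀)
    simpa only [Set.mem_singleton_iff, forall_eq] using this
  · have h : {ω | M.value ω w = a} = ∅ := Set.eq_empty_of_forall_notMem fun ω hω => ha ⟨ω, hω⟩
    rw [h]
    exact ⟨@MeasurableSet.empty _ (M.sigma {w}), fun U _ => .inl (Set.empty_subset U)⟩

theorem isAtomOf_sigma_empty [Finite V] (M : SCM G α) : IsAtomOf (M.sigma ∅) Set.univ where
  measurableSet := @MeasurableSet.univ _ (M.sigma ∅)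
  subset_or_compl := fun U hU => by
    have hs : M.sigma ∅ = ⊥ := by simp [sigma]
    rw [hs, MeasurableSpace.measurableSet_bot_iff] at hU
    rcases hU with rfl | rfl <;> simp

/-- A conditional independence holds on each atom. -/
theorem CondIndepNodes.mul_eq [Fintype V] {M : SCM G α} {i j : V} {S : Set V}
    (h : M.CondIndepNodes i j S) {T : Set M.Sample} (hT : IsAtomOf (M.sigma S) T)
    {s : Set (α i)} {t : Set (α j)} (hs : MeasurableSet s) (ht : MeasurableSet t) :
    M.prob.real ({ω | M.value ω i ∈ s} ∩ {ω | M.value ω j ∈ t} ∩ T) * M.prob.real T =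
      M.prob.real ({ω | M.value ω i ∈ s} ∩ T) * M.prob.real ({ω | M.value ω j ∈ t} ∩ T) := by
  by_cases h0 : M.prob T = 0
  · have : ∀ X : Set M.Sample, M.prob.real (X ∩ T) = 0 := fun X => by
      rw [measureReal_def, measure_mono_null Set.inter_subset_right h0, ENNReal.toReal_zero]
    simp [this]
  · obtain ⟨ω, hω, he⟩ : ∃ ω ∈ T, _ := by
      by_contra hcon
      push Not at hcon
      exact h0 (measure_mono_null (fun ω hω => hcon ω hω) (h s t hs ht))
    have hms : MeasurableSet {ω | M.value ω i ∈ s} := M.measurable_value i hs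
    have hmt : MeasurableSet {ω | M.value ω j ∈ t} := M.measurable_value j ht
    have hle := M.sigma_le S
    rw [← hT.condExp_mul hle (hms.inter hmt) hω, ← hT.condExp_mul hle hms hω,
      ← hT.condExp_mul hle hmt hω, he, Pi.mul_apply]
    ring

/-- A conditional independence can be checked on a countable partition into atoms. -/
theorem condIndepNodes_of_mul_eq [Fintype V] {M : SCM G α} {i j : V} {S : Set V} {ι : Type*}
    [Countable ι] {T : ι → Set M.Sample} (hT : ∀ k, IsAtomOf (M.sigma S) (T k))
    (hcov : ∀ ω, ∃ k, ω ∈ T k)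
    (h : ∀ (s : Set (α i)) (t : Set (α j)), MeasurableSet s → MeasurableSet t → ∀ k,
      M.prob.real ({ω | M.value ω i ∈ s} ∩ {ω | M.value ω j ∈ t} ∩ T k) * M.prob.real (T k) =
        M.prob.real ({ω | M.value ω i ∈ s} ∩ T k) *
          M.prob.real ({ω | M.value ω j ∈ t} ∩ T k)) :
    M.CondIndepNodes i j S := by
  intro s t hs ht
  -- Countability allows all null atoms to be discarded at once, so that division by the mass of the
  -- atom is legitimate.
  have hnull : ∀ᵐ ω ∂M.prob, ∀ k, ω ∈ T k → M.prob.real (T k) ≠ 0 := by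
    rw [ae_all_iff]
    intro k
    by_cases h0 : M.prob (T k) = 0
    · filter_upwards [measure_eq_zero_iff_ae_notMem.1 h0] with ω hω hω' using absurd hω' hω
    · exact .of_forall fun ω _ => (measureReal_ne_zero_iff).2 h0
  filter_upwards [hnull] with ω hω
  obtain ⟨k, hk⟩ := hcov ω
  have h0 := hω k hk
  have hms : MeasurableSet {ω | M.value ω i ∈ s} := M.measurable_value i hs
  have hmt : MeasurableSet {ω | M.value ω j ∈ t} := M.measurable_value j ht
  have hle := M.sigma_le S
  have := h s t hs ht k
  rw [← (hT k).condExp_mul hle (hms.inter hmt) hk, ← (hT k).condExp_mul hle hms hk,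
      ← (hT k).condExp_mul hle hmt hk] at this
  rw [Pi.mul_apply]
  refine mul_right_cancel₀ (mul_ne_zero h0 h0) ?_
  linarith

end SCM

/-! ### Ancestry in the two graphs, and independence from countably many values -/

theorem causal_labelToEnv {L : Link} (h : ∀ v, ¬ Relation.TransGen (edge .causal L) v v) :
    ¬ L.labelToEnv := by
  intro hL
  have h1 : edge .causal L .label .env := hL
  have h2 : edge .causal L .env .mix := trivial
  have h3 : edge .causal L .mix .label := rfl
  exact h .label (((Relation.TransGen.single h1).tail h2).tail h3)

theorem causal_not_inv_env {L : Link} (hL : ¬ L.labelToEnv) :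
    ¬ Relation.ReflTransGen (edge .causal L) .inv .env := by
  refine DAG.not_reflTransGen_of_closed (D := {v | v ≠ .env ∧ v ≠ .confounder}) ?_ (by simp)
    (by simp)
  intro a b
  cases a <;> cases b <;> simp [edge, hL]

theorem antiCausal_not_inv {L : Link} {v : Node} (hv : v = .env ∨ v = .label) :
    ¬ Relation.ReflTransGen (edge .antiCausal L) .inv v := by
  refine DAG.not_reflTransGen_of_closed (D := {v | v = .inv ∨ v = .mix}) ?_ (by simp)
    (by rcases hv with rfl | rfl <;> simp)
  intro a b
  cases a <;> cases b <;> simp [edge]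

/-- A countable-valued variable is independent of an event as soon as the conditional
probabilities of the event given its values agree. -/
theorem measure_inter_preimage_mul_univ {Ω E : Type*} [MeasurableSpace Ω] [MeasurableSpace E]
    [Countable E] [MeasurableSingletonClass E] {μ : Measure Ω} {X : Ω → E} (hX : Measurable X)
    {A : Set Ω} (hA : MeasurableSet A)
    (h : ∀ e e', μ (A ∩ X ⁻¹' {e}) * μ (X ⁻¹' {e'}) = μ (A ∩ X ⁻¹' {e'}) * μ (X ⁻¹' {e}))
    (B : Set E) : μ (A ∩ X ⁻¹' B) * μ Set.univ = μ A * μ (X ⁻¹' B) := by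
  have key : ∀ (ν : Measure Ω) (C : Set E), ν (X ⁻¹' C) = ∑' e : C, ν (X ⁻¹' {e.1}) := by
    intro ν C
    exact (tsum_measure_preimage_singleton C.to_countable
      fun e _ => hX (measurableSet_singleton e)).symm
  have key' : ∀ C : Set E, μ (A ∩ X ⁻¹' C) = ∑' e : C, μ (A ∩ X ⁻¹' {e.1}) := by
    intro C
    have := key (μ.restrict A) C
    simp only [Measure.restrict_apply' hA, Set.inter_comm _ A] at this
    exact this
  have h1 := key μ Set.univ
  have h2 := key' Set.univ
  rw [Set.preimage_univ] at h1 h2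
  rw [Set.inter_univ] at h2
  -- Both sides become double sums over `B` and `E`, which `h` matches term by term. The factor `μ
  -- Set.univ` permits restricted measures that are not normalized.
  rw [key' B, key μ B, h1, h2, ← ENNReal.tsum_mul_right, ← ENNReal.tsum_mul_left]
  refine tsum_congr fun e => ?_
  rw [← ENNReal.tsum_mul_right, ← ENNReal.tsum_mul_left]
  exact tsum_congr fun e' => h e e'

/-! ### The invariances that hold -/

namespace UserModel

variable {t : UserType} {E 𝒳 ℛ : Type} [MeasurableSpace E] [MeasurableSpace 𝒳]
  [MeasurableSpace ℛ]

instance (M : UserModel t E 𝒳 ℛ) : IsProbabilityMeasure M.prob :=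
  inferInstanceAs (IsProbabilityMeasure M.scm.prob)

theorem measurable_env (M : UserModel t E 𝒳 ℛ) : Measurable M.env := M.scm.measurable_value .env

theorem measurable_label (M : UserModel t E 𝒳 ℛ) : Measurable M.label :=
  M.scm.measurable_value .label

theorem measurable_inv (M : UserModel t E 𝒳 ℛ) : Measurable M.inv := M.scm.measurable_value .inv

/-- If the conditional law of `inv` is the same given two events, then so is that of a predictor
that is almost surely a function of `inv`. -/
theorem map_features_eq {M : UserModel t E 𝒳 ℛ} {f : 𝒳 × ℛ → ℝ} {g : M.Inv → ℝ}
    (hg : Measurable g) (hfg : (fun ω => f (M.features ω)) =ᵐ[M.prob] fun ω => g (M.inv ω))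
    {Q Q' : Set M.Ω} (h : (M.prob[|Q]).map M.inv = (M.prob[|Q']).map M.inv) :
    (M.prob[|Q]).map (fun ω => f (M.features ω)) =
      (M.prob[|Q']).map (fun ω => f (M.features ω)) := by
  have key : ∀ Q, (M.prob[|Q]).map (fun ω => f (M.features ω)) =
      ((M.prob[|Q]).map M.inv).map g := fun Q => by
    rw [Measure.map_map hg M.measurable_inv]
    exact Measure.map_congr (cond_absolutelyContinuous.ae_le hfg)
  rw [key, key, h]

theorem marginalInvariance_of_CI [MeasurableSingletonClass E]
    {M : UserModel .causal E 𝒳 ℛ} (hM : M.InvCharacterizesCI)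
    {f : 𝒳 × ℛ → ℝ} (hf : Measurable f) (hCI : M.CI f) : M.MarginalInvariance f := by
  obtain ⟨g, hg, hfg⟩ := hM.2 f hf hCI
  intro e e' he he'
  refine map_features_eq hg hfg ?_
  have hpar : ∀ p, ¬ edge .causal M.link p .inv := by
    intro p
    cases p <;> simp [edge]
  have key : ∀ e, M.prob {ω | M.env ω = e} ≠ 0 → (M.prob[|{ω | M.env ω = e}]).map M.inv =
      (M.scm.law .inv).map (M.scm.mech .inv fun p => absurd p.2 (hpar p)) := fun e he =>
    M.scm.cond_map_value .inv (M.measurable_env (measurableSet_singleton e))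
      (fun ω n => Eq.congr_left (M.scm.value_update
        (causal_not_inv_env (causal_labelToEnv M.acyclic)) ω n))
      _ (fun ω _ p => absurd p.2 (hpar p)) he
  rw [key e he, key e' he']

theorem conditionalInvariance_of_CI [MeasurableSingletonClass E]
    {M : UserModel .antiCausal E 𝒳 ℛ} (hM : M.InvCharacterizesCI)
    {f : 𝒳 × ℛ → ℝ} (hf : Measurable f) (hCI : M.CI f) : M.ConditionalInvariance f := by
  obtain ⟨g, hg, hfg⟩ := hM.2 f hf hCI
  intro y e e' he he'
  refine map_features_eq hg hfg ?_
  have hpar : ∀ p, edge .antiCausal M.link p .inv → p = .label := by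
    intro p
    cases p <;> simp [edge]
  -- `ω₀` serves only to write the label `y` as a tuple of parent values, the same one for `e` and
  -- `e'`.
  obtain ⟨ω₀, -, hω₀⟩ := nonempty_of_measure_ne_zero he
  have key : ∀ e, M.prob {ω | M.env ω = e ∧ M.label ω = y} ≠ 0 →
      (M.prob[|{ω | M.env ω = e ∧ M.label ω = y}]).map M.inv =
      (M.scm.law .inv).map (M.scm.mech .inv fun p => M.scm.value ω₀ p) := fun e he =>
    M.scm.cond_map_value .inv
      ((M.measurable_env (measurableSet_singleton e)).inter
        (M.measurable_label (measurableSet_singleton y)))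
      (fun ω n => and_congr
        (Eq.congr_left (M.scm.value_update (antiCausal_not_inv (.inl rfl)) ω n))
        (Eq.congr_left (M.scm.value_update (antiCausal_not_inv (.inr rfl)) ω n)))
      _ (by
        rintro ω ⟨-, hω⟩ ⟨p, hp⟩
        obtain rfl := hpar p hp
        exact hω.trans hω₀.symm) he
  rw [key e he, key e' he']

/-! ### The invariances that fail under faithfulness -/

/-- The predictor that tests whether `inv` lies in `A`. -/
noncomputable def invIndicator (M : UserModel t E 𝒳 ℛ) (A : Set M.Inv) (z : 𝒳 × ℛ) : ℝ :=
  A.indicator 1 (M.split z).1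

theorem invIndicator_eq (M : UserModel t E 𝒳 ℛ) (A : Set M.Inv) (z : 𝒳 × ℛ) :
    M.invIndicator A z = 0 ∨ M.invIndicator A z = 1 :=
  Set.indicator_eq_zero_or_self _ _ _

theorem measurable_invIndicator (M : UserModel t E 𝒳 ℛ) {A : Set M.Inv} (hA : MeasurableSet A) :
    Measurable (M.invIndicator A) :=
  ((measurable_one.indicator hA).comp measurable_fst).comp M.measurable_split

theorem InvCharacterizesCI.invIndicator {M : UserModel t E 𝒳 ℛ} (hM : M.InvCharacterizesCI)
    {A : Set M.Inv} (hA : MeasurableSet A) : M.CI (M.invIndicator A) :=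
  hM.1 (A.indicator 1) (measurable_one.indicator hA)

theorem measurable_features (M : UserModel t E 𝒳 ℛ) : Measurable M.features :=
  M.measurable_combine.comp ((M.scm.measurable_value .inv).prodMk
    ((M.scm.measurable_value .mix).prodMk (M.scm.measurable_value .spur)))

/-- If the law of the indicator of `inv ∈ A` is the same given two events, then so is the
probability of `inv ∈ A`. -/
theorem measure_mul_eq_of_map_eq {M : UserModel t E 𝒳 ℛ} {A : Set M.Inv} (hA : MeasurableSet A)
    {Q Q' : Set M.Ω} (hQ : MeasurableSet Q) (hQ' : MeasurableSet Q')
    (h : M.prob Q ≠ 0 → M.prob Q' ≠ 0 →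
      (M.prob[|Q]).map (fun ω => M.invIndicator A (M.features ω)) =
      (M.prob[|Q']).map (fun ω => M.invIndicator A (M.features ω))) :
    M.prob (M.inv ⁻¹' A ∩ Q) * M.prob Q' = M.prob (M.inv ⁻¹' A ∩ Q') * M.prob Q := by
  have hz : ∀ {Q}, M.prob Q = 0 → M.prob (M.inv ⁻¹' A ∩ Q) = 0 := fun h0 =>
    measure_mono_null Set.inter_subset_right h0
  by_cases h0 : M.prob Q = 0
  · simp [h0, hz h0]
  by_cases h0' : M.prob Q' = 0
  · simp [h0', hz h0']
  have hmeas : Measurable fun ω => M.invIndicator A (M.features ω) :=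
    (M.measurable_invIndicator hA).comp M.measurable_features
  have hpre : (fun ω => M.invIndicator A (M.features ω)) ⁻¹' {1} = M.inv ⁻¹' A := by
    ext ω
    have h1 : M.invIndicator A (M.features ω) = A.indicator 1 (M.inv ω) := by
      rw [UserModel.invIndicator, features, M.split_combine]
      rfl
    by_cases hω : M.inv ω ∈ A <;> simp [h1, hω]
  have h1 := congrArg (fun ν => ν {1}) (h h0 h0')
  simp only [Measure.map_apply hmeas (measurableSet_singleton (1 : ℝ)), hpre,
    cond_apply hQ, cond_apply hQ'] at h1
  rw [Set.inter_comm Q, Set.inter_comm Q'] at h1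
  calc _ = M.prob Q * (M.prob Q)⁻¹ * M.prob (M.inv ⁻¹' A ∩ Q) * M.prob Q' := by
        rw [ENNReal.mul_inv_cancel h0 (measure_ne_top _ _), one_mul]
    _ = M.prob Q * ((M.prob Q)⁻¹ * M.prob (M.inv ⁻¹' A ∩ Q)) * M.prob Q' := by ring
    _ = (M.prob Q' * (M.prob Q')⁻¹) * M.prob (M.inv ⁻¹' A ∩ Q') * M.prob Q := by
        rw [h1]
        ring
    _ = _ := by rw [ENNReal.mul_inv_cancel h0' (measure_ne_top _ _), one_mul]

variable [Countable E] [MeasurableSingletonClass E]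

/-- The atoms are the two level sets of `label`; on each, invariance of all indicators gives the
product rule for the restricted measure. -/
theorem condIndepNodes_inv_env_label {M : UserModel t E 𝒳 ℛ}
    (h : ∀ A : Set M.Inv, MeasurableSet A → M.ConditionalInvariance (M.invIndicator A)) :
    M.scm.CondIndepNodes .inv .env {.label} := by
  refine SCM.condIndepNodes_of_mul_eq (T := fun y : Bool => {ω | M.label ω = y}) ?_
    (fun ω => ⟨M.label ω, rfl⟩) ?_
  · have : MeasurableSingletonClass (Val E M.Conf M.Inv M.Mix M.Spur .label) :=
      inferInstanceAs (MeasurableSingletonClass Bool)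
    exact M.scm.isAtomOf_sigma_singleton .label
  · intro A B hA hB y
    have hy : MeasurableSet {ω | M.label ω = y} := M.measurable_label (measurableSet_singleton y)
    have := measure_inter_preimage_mul_univ (μ := M.prob.restrict {ω | M.label ω = y})
      M.measurable_env (M.measurable_inv hA) (fun e e' => by
        simp only [Measure.restrict_apply' hy, Set.inter_assoc]
        refine measure_mul_eq_of_map_eq hA
          ((M.measurable_env (measurableSet_singleton e)).inter hy)
          ((M.measurable_env (measurableSet_singleton e')).inter hy) (h A hA y e e')) B
    simp only [Measure.restrict_apply' hy, Set.univ_inter] at this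
    have := congrArg ENNReal.toReal this
    rw [ENNReal.toReal_mul, ENNReal.toReal_mul] at this
    exact this

theorem condIndepNodes_inv_env {M : UserModel t E 𝒳 ℛ}
    (h : ∀ A : Set M.Inv, MeasurableSet A → M.MarginalInvariance (M.invIndicator A)) :
    M.scm.CondIndepNodes .inv .env ∅ := by
  refine SCM.condIndepNodes_of_mul_eq (T := fun _ : Unit => Set.univ) ?_ (fun ω => ⟨(), trivial⟩) ?_
  · exact fun _ => M.scm.isAtomOf_sigma_empty
  · intro A B hA hB _
    have := measure_inter_preimage_mul_univ (μ := M.prob)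
      M.measurable_env (M.measurable_inv hA) (fun e e' => measure_mul_eq_of_map_eq hA
          (M.measurable_env (measurableSet_singleton e))
          (M.measurable_env (measurableSet_singleton e')) (h A hA e e')) B
    simp only [Set.inter_univ]
    have := congrArg ENNReal.toReal this
    rw [ENNReal.toReal_mul, ENNReal.toReal_mul] at this
    exact this

/-- On the path from `inv` through `label` to `env`, directly or via `confounder`, `label` is a
collider and belongs to the conditioning set. -/
theorem not_dSep_causal {L : Link} (hac : ∀ v, ¬ Relation.TransGen (edge .causal L) v v)
    (h : L.commonCause ∨ L.envToLabel ∨ L.labelToEnv) :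
    ¬ DAG.DSep ⟨edge .causal L, hac⟩ .inv .env {.label} := by
  rw [DAG.DSep, not_not]
  rcases h with h | h | h
  · refine ⟨[.inv, .label, .confounder, .env], rfl, rfl, by simp, by simp [edge, h], ?_⟩
    intro a b c habc
    simp only [List.infix_cons_iff, List.prefix_cons_iff] at habc
    simp at habc
    rcases habc with ⟨rfl, rfl, rfl⟩ | ⟨rfl, rfl, rfl⟩ <;> 
      simp [DAG.Unblocked, DAG.Collider, edge, h]
    exact .refl
  · refine ⟨[.inv, .label, .env], rfl, rfl, by simp, by simp [edge, h], ?_⟩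
    intro a b c habc
    simp only [List.infix_cons_iff, List.prefix_cons_iff] at habc
    simp at habc
    obtain ⟨rfl, rfl, rfl⟩ := habc
    simp [DAG.Unblocked, DAG.Collider, edge, h]
    exact .refl
  · exact absurd h (causal_labelToEnv hac)

/-- Here the arrow points from `label` to `inv`, so the path to `env` has no collider and is active
given nothing. -/
theorem not_dSep_antiCausal {L : Link} (hac : ∀ v, ¬ Relation.TransGen (edge .antiCausal L) v v)
    (h : L.commonCause ∨ L.envToLabel ∨ L.labelToEnv) :
    ¬ DAG.DSep ⟨edge .antiCausal L, hac⟩ .inv .env ∅ := by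
  rw [DAG.DSep, not_not]
  rcases h with h | h
  · refine ⟨[.inv, .label, .confounder, .env], rfl, rfl, by simp, by simp [edge, h], ?_⟩
    intro a b c habc
    simp only [List.infix_cons_iff, List.prefix_cons_iff] at habc
    simp at habc
    rcases habc with ⟨rfl, rfl, rfl⟩ | ⟨rfl, rfl, rfl⟩ <;> 
      simp [DAG.Unblocked, DAG.Collider, edge, h]
  · refine ⟨[.inv, .label, .env], rfl, rfl, by simp, by simp [edge, h.symm], ?_⟩
    intro a b c habc
    simp only [List.infix_cons_iff, List.prefix_cons_iff] at habc
    simp at habc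
    obtain ⟨rfl, rfl, rfl⟩ := habc
    simp [DAG.Unblocked, DAG.Collider, edge]

theorem exists_not_conditionalInvariance {M : UserModel .causal E 𝒳 ℛ} (hc : M.Confounded)
    (hM : M.InvCharacterizesCI) (hF : M.Faithful) :
    ∃ f : 𝒳 × ℛ → ℝ, Measurable f ∧ (∀ z, f z = 0 ∨ f z = 1) ∧ M.CI f ∧
      ¬ M.ConditionalInvariance f := by
  by_contra hcon
  have hci : M.scm.CondIndepNodes .inv .env {.label} := condIndepNodes_inv_env_label fun A hA => by
    by_contra hn
    exact hcon ⟨_, M.measurable_invIndicator hA, M.invIndicator_eq A, hM.invIndicator hA, hn⟩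
  have h1 : ({.label} : Set Node) ⊆ {v | v ≠ .confounder} := by simp
  have h2 : Node.inv ∉ ({.label} : Set Node) := by simp
  have h3 : Node.env ∉ ({.label} : Set Node) := by simp
  have h := hF .inv (by simp) .env (by simp) {.label} h1 (by simp) h2 h3
    (not_dSep_causal M.acyclic hc)
  exact h hci

theorem exists_not_marginalInvariance {M : UserModel .antiCausal E 𝒳 ℛ} (hc : M.Confounded)
    (hM : M.InvCharacterizesCI) (hF : M.Faithful) :
    ∃ f : 𝒳 × ℛ → ℝ, Measurable f ∧ (∀ z, f z = 0 ∨ f z = 1) ∧ M.CI f ∧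
      ¬ M.MarginalInvariance f := by
  by_contra hcon
  have hci : M.scm.CondIndepNodes .inv .env ∅ := condIndepNodes_inv_env fun A hA => by
    by_contra hn
    exact hcon ⟨_, M.measurable_invIndicator hA, M.invIndicator_eq A, hM.invIndicator hA, hn⟩
  exact hF .inv (by simp) .env (by simp) ∅ (Set.empty_subset _) (by simp)
    (Set.notMem_empty _) (Set.notMem_empty _) (not_dSep_antiCausal M.acyclic hc) hci

end UserModel

theorem exists_not_invariant {E 𝒳 ℛ : Type} [MeasurableSpace E] [Countable E]
    [MeasurableSingletonClass E] [MeasurableSpace 𝒳] [MeasurableSpace ℛ]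
    {M : ∀ t : UserType, UserModel t E 𝒳 ℛ} (hc : ∀ t, (M t).Confounded)
    (hM : ∀ t, (M t).InvCharacterizesCI) (hF : ∀ t, (M t).Faithful) :
    ∃ f : UserType → 𝒳 × ℛ → ℝ, (∀ t, Measurable (f t)) ∧
      (∀ t z, f t z = 0 ∨ f t z = 1) ∧ (∀ t, (M t).CI (f t)) ∧
      ¬ (M .causal).ConditionalInvariance (f .causal) ∧
      ¬ (M .antiCausal).MarginalInvariance (f .antiCausal) := by
  obtain ⟨f, hf, hf01, hfCI, hfn⟩ := UserModel.exists_not_conditionalInvariance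
    (hc .causal) (hM .causal) (hF .causal)
  obtain ⟨g, hg, hg01, hgCI, hgn⟩ := UserModel.exists_not_marginalInvariance
    (hc .antiCausal) (hM .antiCausal) (hF .antiCausal)
  refine ⟨fun | .causal => f | .antiCausal => g, ?_, ?_, ?_, hfn, hgn⟩
  · rintro (_ | _) <;> assumption
  · rintro (_ | _) <;> assumption
  · rintro (_ | _) <;> assumption

/-! ### Faithful models -/

namespace CountModel

/-- Environment and choice are linked by a common cause only. -/
abbrev commonCauseLink : Link := ⟨True, False, False⟩

/-- The arrows of the graph, as a Boolean function. -/
def hasEdge : UserType → Node → Node → Bool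
  | _, .confounder, .env => true
  | _, .confounder, .label => true
  | _, .env, .mix => true
  | _, .env, .spur => true
  | _, .inv, .mix => true
  | .causal, .inv, .label => true
  | .causal, .mix, .label => true
  | .causal, .mix, .spur => true
  | .antiCausal, .label, .inv => true
  | .antiCausal, .label, .mix => true
  | .antiCausal, .spur, .mix => true
  | _, _, _ => false

theorem hasEdge_iff {t : UserType} {a b : Node} :
    hasEdge t a b = true ↔ edge t commonCauseLink a b := by
  cases t <;> cases a <;> cases b <;> simp [hasEdge, edge]

/-- A topological ordering. -/
def rank : UserType → Node → ℕ
  | _, .confounder => 0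
  | _, .env => 1
  | .causal, .inv => 1
  | .causal, .mix => 2
  | .causal, .spur => 3
  | .causal, .label => 3
  | .antiCausal, .label => 1
  | .antiCausal, .inv => 2
  | .antiCausal, .spur => 2
  | .antiCausal, .mix => 3

theorem rank_lt {t : UserType} {a b : Node} (h : edge t commonCauseLink a b) :
    rank t a < rank t b := by
  rw [← hasEdge_iff] at h
  revert h
  cases t <;> cases a <;> cases b <;> simp [hasEdge, rank]

theorem acyclic (t : UserType) (v : Node) :
    ¬ Relation.TransGen (edge t commonCauseLink) v v := by
  have : ∀ a b, Relation.TransGen (edge t commonCauseLink) a b → rank t a < rank t b := by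
    intro a b h
    induction h with
    | single h => exact rank_lt h
    | tail _ h ih => exact ih.trans (rank_lt h)
  exact fun h => lt_irrefl _ (this v v h)

/-- The graph of the models. -/
abbrev graph (t : UserType) : DAG Node := ⟨edge t commonCauseLink, acyclic t⟩

/-- All variables are binary. -/
abbrev BVal : Node → Type := Val Bool Bool Bool Bool Bool

def ofBool : ∀ v, Bool → BVal v
  | .env, b => b
  | .label, b => b
  | .confounder, b => b
  | .inv, b => b
  | .mix, b => b
  | .spur, b => b

def toBool : ∀ v, BVal v → Bool
  | .env, b => b
  | .label, b => b
  | .confounder, b => b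
  | .inv, b => b
  | .mix, b => b
  | .spur, b => b

@[simp]
theorem toBool_ofBool (v : Node) (b : Bool) : toBool v (ofBool v b) = b := by
  cases v <;> rfl

@[simp]
theorem ofBool_toBool (v : Node) (b : BVal v) : ofBool v (toBool v b) = b := by
  cases v <;> rfl

instance (v : Node) : Finite (BVal v) :=
  Finite.of_injective (toBool v) fun a b h => by
    rw [← ofBool_toBool v a, h, ofBool_toBool]

instance (v : Node) : MeasurableSingletonClass (BVal v) := by
  cases v <;> exact inferInstanceAs (MeasurableSingletonClass Bool)

/-- The number of parents of `v` with value `true`. -/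
def parentCount (t : UserType) (v : Node) (x : Node → Bool) : ℕ :=
  (hasEdge t .env v && x .env).toNat + (hasEdge t .label v && x .label).toNat +
    (hasEdge t .confounder v && x .confounder).toNat + (hasEdge t .inv v && x .inv).toNat +
    (hasEdge t .mix v && x .mix).toNat + (hasEdge t .spur v && x .spur).toNat

theorem parentCount_congr {t : UserType} {v : Node} {x y : Node → Bool}
    (h : ∀ p, hasEdge t p v = true → x p = y p) : parentCount t v x = parentCount t v y := by
  have : ∀ p, (hasEdge t p v && x p) = (hasEdge t p v && y p) := by
    intro p
    cases hp : hasEdge t p v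
    · rfl
    · simp [h p hp]
  simp only [parentCount, this]

/-- The bound keeps the threshold `1 + k` between 1 and 5, so noise 0 always yields `true` and noise
5 always `false`. -/
theorem parentCount_le (t : UserType) (v : Node) (x : Node → Bool) : parentCount t v x ≤ 4 := by
  have h := fun p => Bool.toNat_le (x p)
  have h1 := h .env
  have h2 := h .label
  have h3 := h .confounder
  have h4 := h .inv
  have h5 := h .mix
  have h6 := h .spur
  cases t <;> cases v <;> simp [parentCount, hasEdge] <;> omega

/-- Each variable is `true` with probability `(1 + k) / 6`, where `k` is the number of its parents
that are `true`. -/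
noncomputable def scm (t : UserType) : SCM (graph t) BVal where
  Noise _ := Fin 6
  law _ := (PMF.uniformOfFintype (Fin 6)).toMeasure
  mech v pa n := ofBool v (decide (n.1 < 1 + parentCount t v fun p =>
    if h : hasEdge t p v = true then toBool p (pa ⟨p, hasEdge_iff.1 h⟩) else false))
  measurable_mech _ := Measurable.of_discrete

theorem mech_ofBool (t : UserType) (v : Node) (x : Node → Bool) (n : Fin 6) :
    (scm t).mech v (fun p => ofBool p (x p)) n =
      ofBool v (decide (n.1 < 1 + parentCount t v x)) := by
  simp only [scm, toBool_ofBool]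
  congr 4
  exact parentCount_congr fun p hp => by simp [hp]

noncomputable def model (t : UserType) : UserModel t Bool (Bool × Bool) Bool where
  link := commonCauseLink
  acyclic := acyclic t
  Conf := Bool
  Inv := Bool
  Mix := Bool
  Spur := Bool
  scm := scm t
  combine z := ((z.1, z.2.1), z.2.2)
  split z := (z.1.1, z.1.2, z.2)
  measurable_combine := Measurable.of_discrete
  measurable_split := Measurable.of_discrete
  split_combine _ := rfl

/-! #### Counterfactual invariance -/

theorem not_env_inv (t : UserType) :
    ¬ Relation.ReflTransGen (edge t commonCauseLink) .env .inv := by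
  cases t
  · refine DAG.not_reflTransGen_of_closed (D := {v | v ≠ .confounder ∧ v ≠ .inv}) ?_ (by simp)
      (by simp)
    intro a b
    cases a <;> cases b <;> simp [edge]
  · refine DAG.not_reflTransGen_of_closed (D := {v | v = .env ∨ v = .mix ∨ v = .spur}) ?_ (by simp)
      (by simp)
    intro a b
    cases a <;> cases b <;> simp [edge]

theorem featuresAt_eq {t : UserType} {x : Node → Bool} {ω : Node → Fin 6}
    (h : ∀ v, v ≠ .env → decide ((ω v).1 < 1 + parentCount t v x) = x v) :
    (model t).featuresAt (x .env) ω = ((x .inv, x .mix), x .spur) := by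
  have h1 : (scm t).potential .env (ofBool .env (x .env)) ω = fun v => ofBool v (x v) :=
    ((scm t).potential_eq_iff (w := .env) ω fun v => ofBool v (x v)).2 fun v hv => by
      rw [mech_ofBool]
      exact congrArg _ (h v hv)
  have h2 : ∀ v, (scm t).potential .env (ofBool .env (x .env)) ω v = ofBool v (x v) :=
    fun v => congrFun h1 v
  exact Prod.ext (Prod.ext (h2 .inv) (h2 .mix)) (h2 .spur)

/-- Full support upgrades almost sure statements to statements about every noise vector. -/
theorem prob_singleton_ne_zero (t : UserType) (ω : Node → Fin 6) : (scm t).prob {ω} ≠ 0 := by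
  have : (scm t).prob {ω} = ∏ v, (scm t).law v {ω v} := Measure.pi_singleton _ _
  rw [this, Finset.prod_ne_zero_iff]
  intro v _
  have h : (scm t).law v {ω v} = PMF.uniformOfFintype (Fin 6) (ω v) :=
    PMF.toMeasure_apply_singleton _ _ (measurableSet_singleton _)
  rw [h, PMF.uniformOfFintype_apply]
  simp

theorem CI_apply {t : UserType} {f : (Bool × Bool) × Bool → ℝ} (hf : (model t).CI f)
    (ω : Node → Fin 6) :
    f ((model t).featuresAt false ω) = f ((model t).featuresAt true ω) := by
  by_contra h
  refine prob_singleton_ne_zero t ω (measure_mono_null ?_ (hf false true))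
  rintro _ rfl
  exact h

/-- Two configurations that can occur together, as potential outcomes in the two environments. -/
theorem CI_eq {t : UserType} {f : (Bool × Bool) × Bool → ℝ} (hf : (model t).CI f)
    {x y : Node → Bool} (hx : x .env = false) (hy : y .env = true)
    (h : ∀ v, v ≠ .env → x v = y v ∨
      (x v = false ∧ y v = true ∧ parentCount t v x < parentCount t v y)) :
    f ((x .inv, x .mix), x .spur) = f ((y .inv, y .mix), y .spur) := by
  have key : ∀ v, ∃ n : Fin 6, v ≠ .env →
      decide (n.1 < 1 + parentCount t v x) = x v ∧
      decide (n.1 < 1 + parentCount t v y) = y v := by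
    intro v
    by_cases hv : v = .env
    · exact ⟨0, fun h => absurd hv h⟩
    have hcx := parentCount_le t v x
    have hcy := parentCount_le t v y
    -- Noise 5 or 0 keeps a value constant; noise `1 + parentCount t v x` is the first to give
    -- `false` for `x`, and gives `true` for the larger count of `y`. One noise vector thus produces
    -- both configurations.
    rcases h v hv with h | ⟨h1, h2, h3⟩
    · cases hxv : x v
      · refine ⟨5, fun _ => ?_⟩
        rw [← h, hxv]
        simp
        omega
      · refine ⟨0, fun _ => ?_⟩
        rw [← h, hxv]
        simp
    · refine ⟨⟨1 + parentCount t v x, by omega⟩, fun _ => ?_⟩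
      rw [h1, h2]
      simpa using h3
  choose ω hω using key
  have h1 := featuresAt_eq (ω := ω) fun v hv => (hω v hv).1
  have h2 := featuresAt_eq (ω := ω) fun v hv => (hω v hv).2
  rw [← h1, ← h2, hx, hy]
  exact CI_apply hf ω

/-- The configuration with the given values. -/
def config (e y c a b s : Bool) : Node → Bool
  | .env => e
  | .label => y
  | .confounder => c
  | .inv => a
  | .mix => b
  | .spur => s

theorem invCharacterizesCI (t : UserType) : (model t).InvCharacterizesCI := by
  constructor
  · intro g _ e e'
    refine Filter.Eventually.of_forall fun ω => congrArg g ?_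
    exact ((scm t).potential_eq (ofBool .env e) (not_env_inv t) ω).trans
      ((scm t).potential_eq (ofBool .env e') (not_env_inv t) ω).symm
  · intro f _ hf
    -- Switching on `env` adds a true parent to `spur`, which may flip while all other nodes stay
    -- fixed; likewise for `mix` below.
    have hs : ∀ a b, f ((a, b), false) = f ((a, b), true) := by
      intro a b
      refine CI_eq hf (x := config false false false a b false)
        (y := config true false false a b true) rfl rfl ?_
      intro v hv
      cases t <;> cases v <;> simp [config, parentCount, hasEdge] at hv ⊢
    have hm : ∀ a s, f ((a, false), s) = f ((a, true), s) := by
      intro a s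
      refine CI_eq hf (x := config false false false a false s)
        (y := config true false false a true s) rfl rfl ?_
      intro v hv
      cases t <;> cases v <;> simp [config, parentCount, hasEdge] at hv ⊢
    refine ⟨fun a => f ((a, false), false), Measurable.of_discrete (α := Bool), ?_⟩
    refine Filter.Eventually.of_forall fun ω => ?_
    have key : ∀ a b s, f ((a, b), s) = f ((a, false), false) := by
      rintro a (_ | _) (_ | _)
      · rfl
      · exact (hs a false).symm
      · exact (hm a false).symm
      · exact (hs a true).symm.trans (hm a false).symm
    exact key _ _ _

/-! #### The joint distribution -/

theorem law_real (t : UserType) (v : Node) {k : ℕ} (hk : k ≤ 4) (b : Bool) :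
    ((scm t).law v).real {n : Fin 6 | decide (n.1 < 1 + k) = b} =
      ((bif b then 1 + k else 5 - k : ℕ) : ℝ) / 6 := by
  have hset : {n : Fin 6 | decide (n.1 < 1 + k) = b} =
      ↑(Finset.univ.filter fun n : Fin 6 => decide (n.1 < 1 + k) = b) := by simp
  have hcard : (Finset.univ.filter fun n : Fin 6 => decide (n.1 < 1 + k) = b).card =
      bif b then 1 + k else 5 - k := by
    clear hset
    interval_cases k <;> cases b <;> rfl
  have h : (scm t).law v {n : Fin 6 | decide (n.1 < 1 + k) = b} = _ :=
    hset ▸ PMF.toMeasure_apply_finset _ _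
  rw [measureReal_def, h]
  simp only [PMF.uniformOfFintype_apply, Fintype.card_fin, Finset.sum_const, hcard]
  simp [div_eq_mul_inv]

/-- The probability of a value of `v` given its parents, in sixths. -/
def nodeWeight (t : UserType) (v : Node) (x : Node → Bool) : ℕ :=
  bif x v then 1 + parentCount t v x else 5 - parentCount t v x

/-- The probability of a configuration, up to normalization. -/
def weight (t : UserType) (x : Node → Bool) : ℕ :=
  nodeWeight t .env x * nodeWeight t .label x * nodeWeight t .confounder x *
    nodeWeight t .inv x * nodeWeight t .mix x * nodeWeight t .spur x

/-- The values of all variables, as Booleans. -/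
noncomputable def observe (t : UserType) (ω : (scm t).Sample) (v : Node) : Bool :=
  toBool v ((scm t).value ω v)

theorem observe_eq_iff {t : UserType} {ω : (scm t).Sample} {v : Node} {b : Bool} :
    observe t ω v = b ↔ (scm t).value ω v = ofBool v b := by
  rw [observe]
  constructor
  · rintro rfl
    simp
  · intro h
    simp [h]

theorem measurable_observe (t : UserType) : Measurable (observe t) :=
  measurable_pi_lambda _ fun v =>
    (Measurable.of_discrete (f := toBool v)).comp ((scm t).measurable_value v)

/-- Uniqueness of the solution makes the event a box in noise space, whose mass is a product of six
factors in sixths. -/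
theorem prob_observe_singleton (t : UserType) (x : Node → Bool) :
    (scm t).prob.real (observe t ⁻¹' {x}) = (weight t x : ℝ) / 6 ^ 6 := by
  have h : observe t ⁻¹' {x} =
      Set.pi Set.univ fun v => {n : Fin 6 | decide (n.1 < 1 + parentCount t v x) = x v} := by
    ext ω
    have h1 : observe t ω = x ↔ (scm t).value ω = fun v => ofBool v (x v) := by
      simp only [funext_iff, observe_eq_iff]
    rw [Set.mem_preimage, Set.mem_singleton_iff, h1, SCM.value_eq_iff]
    refine Iff.trans (forall_congr' fun v => ?_) Set.mem_univ_pi.symm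
    refine (Eq.congr_left (mech_ofBool t v x (ω v))).trans ?_
    refine ⟨fun h => ?_, fun h => congrArg _ h⟩
    have h' := congrArg (toBool v) h
    rw [toBool_ofBool, toBool_ofBool] at h'
    exact h'
  have h2 : (scm t).prob.real (observe t ⁻¹' {x}) =
      ∏ v, ((scm t).law v).real
        {n : Fin 6 | decide (n.1 < 1 + parentCount t v x) = x v} := by
    rw [h]
    simp only [measureReal_def, ← ENNReal.toReal_prod]
    exact congrArg _ (Measure.pi_pi _ _)
  have h3 : (Finset.univ : Finset Node) = {.env, .label, .confounder, .inv, .mix, .spur} := rfl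
  rw [h2, Finset.prod_congr rfl fun v _ => law_real t v (parentCount_le t v x) (x v), h3]
  simp [weight, nodeWeight]
  ring

/-- A sum over all configurations. -/
def sumConfig (F : (Node → Bool) → ℕ) : ℕ :=
  let two (f : Bool → ℕ) : ℕ := f true + f false
  two fun e => two fun y => two fun c => two fun a => two fun b => two fun s =>
    F (config e y c a b s)

theorem sum_eq_sumConfig (F : (Node → Bool) → ℕ) : ∑ x, F x = sumConfig F := by
  let eqv : (Bool × Bool × Bool × Bool × Bool × Bool) ≃ (Node → Bool) :=
    { toFun := fun z => config z.1 z.2.1 z.2.2.1 z.2.2.2.1 z.2.2.2.2.1 z.2.2.2.2.2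
      invFun := fun x => (x .env, x .label, x .confounder, x .inv, x .mix, x .spur)
      left_inv := fun _ => rfl
      right_inv := fun x => by
        funext v
        cases v <;> rfl }
  rw [← eqv.sum_comp]
  simp only [Fintype.sum_prod_type, Fintype.sum_bool]
  rfl

/-- The probability of an event described by the values of the variables, up to normalization. -/
def eventWeight (t : UserType) (C : (Node → Bool) → Bool) : ℕ :=
  sumConfig fun x => bif C x then weight t x else 0

theorem prob_observe (t : UserType) (C : (Node → Bool) → Bool) :
    (scm t).prob.real {ω | C (observe t ω) = true} = (eventWeight t C : ℝ) / 6 ^ 6 := by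
  have h : {ω | C (observe t ω) = true} =
      observe t ⁻¹' ↑(Finset.univ.filter fun x => C x = true) := by
    ext ω
    simp
  rw [h, ← sum_measureReal_preimage_singleton _
    fun x _ => measurable_observe t (Set.toFinite {x}).measurableSet, eventWeight,
    ← sum_eq_sumConfig, Finset.sum_filter, Nat.cast_sum, Finset.sum_div]
  refine Finset.sum_congr rfl fun x _ => ?_
  rw [prob_observe_singleton]
  cases C x <;> simp

/-- The configurations `x` and `z` agree on `S`. -/
def agree (S z x : Node → Bool) : Bool :=
  [Node.env, .label, .confounder, .inv, .mix, .spur].all fun v => !S v || x v == z v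

theorem agree_iff {S z x : Node → Bool} : agree S z x = true ↔ ∀ v, S v = true → x v = z v := by
  constructor
  · intro h v hv
    simp only [agree, List.all_eq_true] at h
    have := h v (by cases v <;> simp)
    simpa [hv] using this
  · intro h
    simp only [agree, List.all_eq_true]
    intro v _
    cases hv : S v
    · rfl
    · simp [h v hv]

/-- Given the values of `z` on `S`, the events that `i` and that `j` are true are dependent. -/
def dependentAt (t : UserType) (i j : Node) (S z : Node → Bool) : Bool :=
  eventWeight t (fun x => x i && x j && agree S z x) * eventWeight t (agree S z) !=
    eventWeight t (fun x => x i && agree S z x) * eventWeight t (fun x => x j && agree S z x)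

theorem not_condIndepNodes {t : UserType} {i j : Node} {S z : Node → Bool}
    (h : dependentAt t i j S z = true) :
    ¬ (scm t).CondIndepNodes i j {v | S v = true} := by
  intro hc
  have hT := (scm t).isAtomOf_sigma {v | S v = true} (fun v _ => inferInstance)
    fun v => ofBool v (z v)
  have := hc.mul_eq hT (measurableSet_singleton (ofBool i true))
    (measurableSet_singleton (ofBool j true))
  have hTz : {ω | ∀ v ∈ {v | S v = true}, (scm t).value ω v = ofBool v (z v)} =
      {ω | agree S z (observe t ω) = true} := by
    ext ω
    simp only [Set.mem_ofPred_eq, agree_iff, observe_eq_iff]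
  have hv : ∀ v, {ω | (scm t).value ω v ∈ ({ofBool v true} : Set (BVal v))} =
      {ω | observe t ω v = true} := by
    intro v
    ext ω
    simp only [Set.mem_ofPred_eq, Set.mem_singleton_iff, observe_eq_iff]
  rw [hTz, hv, hv] at this
  simp only [← Set.ofPred_and, ← Bool.and_eq_true] at this
  have e1 := prob_observe t fun x => x i && x j && agree S z x
  have e2 := prob_observe t (agree S z)
  have e3 := prob_observe t fun x => x i && agree S z x
  have e4 := prob_observe t fun x => x j && agree S z x
  rw [e1, e2, e3, e4] at this
  have h' : eventWeight t (fun x => x i && x j && agree S z x) * eventWeight t (agree S z) ≠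
    eventWeight t (fun x => x i && agree S z x) * eventWeight t (fun x => x j && agree S z x) := by
    simpa [dependentAt] using h
  apply h'
  -- Each side carries the factor `6 ^ 6` twice in its denominator, leaving an identity of integer
  -- weights.
  field_simp at this
  exact_mod_cast this

/-! #### d-separation -/

def nodes : List Node := [.env, .label, .confounder, .inv, .mix, .spur]

theorem mem_nodes (v : Node) : v ∈ nodes := by
  cases v <;> simp [nodes]

/-- There is a directed path, of length at most two, from `a` to `b`. -/
def descendant (t : UserType) (a b : Node) : Bool :=
  decide (a = b) || hasEdge t a b || nodes.any fun m => hasEdge t a m && hasEdge t m b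

theorem descendant_of_reflTransGen {t : UserType} {a b : Node}
    (h : Relation.ReflTransGen (edge t commonCauseLink) a b) : descendant t a b = true := by
  -- Length two suffices because appending an edge leads to no new descendant, as enumeration
  -- confirms.
  have hstep : ∀ a b c, hasEdge t b c = true → descendant t a b = true →
      descendant t a c = true := by
    cases t <;> decide
  induction h with
  | refl => simp [descendant]
  | tail _ hbc ih => exact hstep _ _ _ (hasEdge_iff.2 hbc) ih

/-- The Boolean counterpart of `DAG.Unblocked`. -/
def unblocked (t : UserType) (S : Node → Bool) (a b c : Node) : Bool :=
  bif hasEdge t a b && hasEdge t c b then nodes.any fun d => S d && descendant t b d else !S b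

/-- Only this direction is needed: allowing too many continuations cannot make a separation
certificate unsound. -/
theorem unblocked_of_unblocked {t : UserType} {S : Node → Bool} {a b c : Node}
    (h : (graph t).Unblocked {v | S v = true} a b c) : unblocked t S a b c = true := by
  have hcol : (graph t).Collider a b c ↔ (hasEdge t a b && hasEdge t c b) = true := by
    rw [Bool.and_eq_true, hasEdge_iff, hasEdge_iff, DAG.Collider]
  rw [unblocked]
  cases hc : (hasEdge t a b && hasEdge t c b)
  · have := h.2 (by simp [hcol, hc])
    simpa using this
  · obtain ⟨d, hd, hbd⟩ := h.1 (hcol.2 hc)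
    rw [cond_true, List.any_eq_true]
    exact ⟨d, mem_nodes d, by
      rw [Bool.and_eq_true]
      exact ⟨hd, descendant_of_reflTransGen hbd⟩⟩

def adjacent (t : UserType) (a b : Node) : Bool := hasEdge t a b || hasEdge t b a

/-- Bit masks represent sets of pairs of nodes. -/
def pairIndex (a b : Node) : ℕ := 6 * a.ctorIdx + b.ctorIdx

/-- The last steps of the active walks from `i` given `S` of at most the given length. -/
def reach (t : UserType) (i : Node) (S : Node → Bool) : ℕ → ℕ
  | 0 => 0
  | k + 1 => nodes.foldl (fun m b => nodes.foldl (fun m c =>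
      bif adjacent t b c && (decide (b = i) ||
        nodes.any fun a => (reach t i S k).testBit (pairIndex a b) && unblocked t S a b c)
      then m ||| 2 ^ pairIndex b c else m) m) 0

/-- The certificate for d-separation is checked. -/
def separates (t : UserType) (i j : Node) (S : Node → Bool) (R : ℕ) : Bool :=
  (nodes.all fun v => !adjacent t i v || R.testBit (pairIndex i v)) &&
  (nodes.all fun a => nodes.all fun b => !R.testBit (pairIndex a b) ||
    nodes.all fun c => !(adjacent t b c && unblocked t S a b c) || R.testBit (pairIndex b c)) &&
  nodes.all fun a => !R.testBit (pairIndex a j)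

/-- `R` is arbitrary and its closure is checked directly, so nothing has to be proved about how
`reach` computes it. -/
theorem dSep_of_separates {t : UserType} {i j : Node} {S : Node → Bool} {R : ℕ} (hij : i ≠ j)
    (h : separates t i j S R = true) : (graph t).DSep i j {v | S v = true} := by
  simp only [separates, Bool.and_eq_true, List.all_eq_true] at h
  obtain ⟨⟨h0, hs⟩, hj⟩ := h
  have hadj : ∀ a b, edge t commonCauseLink a b ∨ edge t commonCauseLink b a →
      adjacent t a b = true := by
    intro a b h
    simpa [adjacent, hasEdge_iff] using h
  refine DAG.DSep.of_invariant (fun a b => R.testBit (pairIndex a b) = true) hij ?_ ?_ ?_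
  · intro v hv
    simpa [hadj i v hv] using h0 v (mem_nodes v)
  · intro a b c hab hbc hu
    have := hs a (mem_nodes a) b (mem_nodes b)
    rw [hab, Bool.not_true, Bool.false_or, List.all_eq_true] at this
    simpa [hadj b c hbc, unblocked_of_unblocked hu] using this c (mem_nodes c)
  · intro a ha
    simpa [ha] using hj a (mem_nodes a)

/-! #### Faithfulness -/

/-- Any two nodes are dependent given `S` or d-separated by `S`. -/
def faithfulFor (t : UserType) (i j : Node) (S : Node → Bool) : Bool :=
  -- The all-false atom as witness of dependence and five rounds of `reach` are choices that the
  -- computation in `faithfulAll_eq_true` shows to be sufficient.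
  S i || S j || dependentAt t i j S (fun _ => false) || separates t i j S (reach t i S 5)

def faithfulAt (t : UserType) (i j : Node) : Bool :=
  let both (p : Bool → Bool) : Bool := p true && p false
  both fun e => both fun y => both fun a => both fun b => both fun s =>
    faithfulFor t i j (config e y false a b s)

theorem faithfulFor_of_faithfulAt {t : UserType} {i j : Node} (h : faithfulAt t i j = true)
    {S : Node → Bool} (hS : S .confounder = false) : faithfulFor t i j S = true := by
  have hSc : S = config (S .env) (S .label) false (S .inv) (S .mix) (S .spur) := by
    funext v
    cases v <;> simp [config, hS]
  rw [hSc]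
  simp only [faithfulAt, Bool.and_eq_true] at h
  generalize S .env = e, S .label = y, S .inv = a, S .mix = b, S .spur = s
  cases e <;> cases y <;> cases a <;> cases b <;> cases s <;> simp only [h]

def faithfulAll (t : UserType) : Bool :=
  nodes.all fun i => nodes.all fun j => decide (i = .confounder) || decide (j = .confounder) ||
    decide (i = j) || faithfulAt t i j

theorem faithfulAll_eq_true (t : UserType) : faithfulAll t = true := by
  cases t <;> decide +kernel

theorem faithful (t : UserType) : (model t).Faithful := by
  classical
  intro i hi j hj S hS hij hiS hjS hsep hind
  let Sb : Node → Bool := fun v => decide (v ∈ S)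
  have hSb : S = {v | Sb v = true} := by
    ext v
    simp [Sb]
  have hall := faithfulAll_eq_true t
  simp only [faithfulAll, List.all_eq_true] at hall
  have hat : faithfulAt t i j = true := by
    simpa [show i ≠ .confounder from hi, show j ≠ .confounder from hj, hij] using
      hall i (mem_nodes i) j (mem_nodes j)
  have hfor := faithfulFor_of_faithfulAt hat (S := Sb)
    (by simpa [Sb] using fun h => hS h rfl)
  simp only [faithfulFor, Bool.or_eq_true] at hfor
  rcases hfor with ((h | h) | h) | h
  · exact hiS (by simpa [Sb] using h)
  · exact hjS (by simpa [Sb] using h)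
  · exact not_condIndepNodes h (hSb ▸ hind)
  · exact hsep (hSb ▸ dSep_of_separates hij h)

end CountModel

end CausalUsers

/-! ### The proposition -/

open CausalUsers in
theorem mainTheorem1 :
    (∀ (E 𝒳 ℛ : Type) [MeasurableSpace E] [Countable E] [MeasurableSingletonClass E]
      [MeasurableSpace 𝒳] [MeasurableSpace ℛ] (M : ∀ t : UserType, UserModel t E 𝒳 ℛ),
      (∀ t, (M t).Confounded) → (∀ t, (M t).InvCharacterizesCI) →
        (∀ f : UserType → 𝒳 × ℛ → ℝ, (∀ t, Measurable (f t)) → (∀ t, (M t).CI (f t)) →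
          (M .causal).MarginalInvariance (f .causal) ∧
            (M .antiCausal).ConditionalInvariance (f .antiCausal)) ∧
        ((∀ t, (M t).Faithful) →
          ∃ f : UserType → 𝒳 × ℛ → ℝ, (∀ t, Measurable (f t)) ∧
            (∀ t z, f t z = 0 ∨ f t z = 1) ∧ (∀ t, (M t).CI (f t)) ∧
            ¬ (M .causal).ConditionalInvariance (f .causal) ∧
            ¬ (M .antiCausal).MarginalInvariance (f .antiCausal))) ∧
    ∃ (M : ∀ t : UserType, UserModel t Bool (Bool × Bool) Bool)
      (f : UserType → (Bool × Bool) × Bool → ℝ),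
      (∀ t, (M t).link = ⟨True, False, False⟩) ∧ (∀ t, (M t).InvCharacterizesCI) ∧
        (∀ t, (M t).Faithful) ∧ (∀ t, Measurable (f t)) ∧
        (∀ t z, f t z = 0 ∨ f t z = 1) ∧ (∀ t, (M t).CI (f t)) ∧
        ¬ (M .causal).ConditionalInvariance (f .causal) ∧
        ¬ (M .antiCausal).MarginalInvariance (f .antiCausal) := by
  refine ⟨fun E 𝒳 ℛ _ _ _ _ _ M hc hM => ⟨fun f hf hCI => ⟨?_, ?_⟩, ?_⟩, ?_⟩
  · exact UserModel.marginalInvariance_of_CI (hM .causal) (hf .causal) (hCI .causal)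
  · exact UserModel.conditionalInvariance_of_CI (hM .antiCausal) (hf .antiCausal)
      (hCI .antiCausal)
  · exact exists_not_invariant hc hM
  · obtain ⟨f, hf⟩ := exists_not_invariant (M := CountModel.model) (fun _ => .inl trivial)
      CountModel.invCharacterizesCI CountModel.faithful
    exact ⟨CountModel.model, f, fun _ => rfl, CountModel.invCharacterizesCI,
      CountModel.faithful, hf⟩
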